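/- Let $N\ge 2$, $\nu\ge 2$, $n\ge 0$ be integers and $r>0$. Let $\vec x$ be the vector of $(2\nu+1)N+1$ independent complex variables consisting of the coordinates of the initial positions $q_i^0$ and velocities $v_i^0$ ($1\le i\le N$, each with $\nu$ components), the masses $m_1,\dots,m_N$ and the size $L$ of the torus. Write $\mathbb K_0=\mathbb C(\vec x)$, and let $\overline{\mathbb K}_0$ be its algebraic closure. $\langle\cdot,\cdot\rangle$ denotes the bilinear form $\langle u,w\rangle=\sum_c u_cw_c$. A discrete orbit structure $(\Sigma,\mathcal A,\vec\tau)$ consists of a sequence of pairs $\sigma_k=(i_k,j_k)$, $i_k\ne j_k$, of labels in $\{1,\dots,N\}$, of vectors $a_k\in\mathbb Z^\nu$, and of elements $\tau_k\in\overline{\mathbb K}_0$ ($k=1,\dots,n$) such that, recursively, $\tau_k$ is a root of $$\|w_k\|^2\tau^2+2\langle w_k,u_k\rangle\tau+\|u_k\|^2-4r^2=0,\qquad w_k=v^{k-1}_{i_k}-v^{k-1}_{j_k},\quad u_k=q^{k-1}_{i_k}-q^{k-1}_{j_k}-L a_k ,$$ where $\|u\|^2=\langle u,u\rangle$, $q_i^k=q_i^{k-1}+\tau_kv_i^{k-1}$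 for all $i$, $v_i^k=v_i^{k-1}$ for $i\notin\sigma_k$, and, with $u'_k=q^k_{i_k}-q^k_{j_k}-La_k$, $$v^k_{i_k}=v^{k-1}_{i_k}-\tfrac{m_{j_k}}{m_{i_k}+m_{j_k}}\tfrac1{2r^2}\langle w_k,u'_k\rangle u'_k,\qquad v^k_{j_k}=v^{k-1}_{j_k}+\tfrac{m_{i_k}}{m_{i_k}+m_{j_k}}\tfrac1{2r^2}\langle w_k,u'_k\rangle u'_k .$$ The neutrality equations are the $\nu n$ homogeneous linear equations $$W^{(k)}_{i_k}-\alpha_kv^{k-1}_{i_k}=W^{(k)}_{j_k}-\alpha_kv^{k-1}_{j_k}\quad(1\le k\le n),\qquad W^{(k)}_i=W_i+\sum_{l<k}\alpha_l\,(v_i^l-v_i^{l-1}),$$ for the $\nu N+n$ unknowns $W=(W_1,\dots,W_N)$, $W_i$ with $\nu$ components, and $\alpha_1,\dots,\alpha_n$ (the advances). An orbit is non-sufficient if its neutral space, the space of the solutions $W$, has dimension greater than $\nu+1$; this is expressed by the vanishing of all minors of order $\nu N+n-\nu-1$ of this system. Let $f_1,\dots,f_s\in\overline{\mathbb K}_0$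 be a finite family that spans the same complex vector space as these minors (for instance, the minors themselves), and let the non-sufficiency polynomial $P_k\in\mathbb C[\vec x]$ be the numerator, in lowest terms, of the product of all conjugates of $f_k$ over $\mathbb K_0$ (the roots of its minimal polynomial). Then each of $P_1,\dots,P_s$ is homogeneous in the mass variables $m_1,\dots,m_N$ (all of its monomials have the same total degree in $m_1,\dots,m_N$). Consequently, if $P_1,\dots,P_s$ are not all identically zero, then every common divisor $Q\in\mathbb C[\vec x]$ of them is also homogeneous in the masses. -/

import Mathlib

noncomputable section

namespace HardBall

/-- The coordinates of the vector of initial data of `N` balls in dimension `ν`: positions,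
velocities, masses and the size `L` of the torus, `(2 * ν + 1) * N + 1` variables in total. -/
inductive Var (N ν : ℕ) : Type
  | pos (i : Fin N) (c : Fin ν)
  | vel (i : Fin N) (c : Fin ν)
  | mass (i : Fin N)
  | size

/-- Polynomials with complex coefficients in the initial data. -/
abbrev Poly (N ν : ℕ) : Type := MvPolynomial (Var N ν) ℂ

/-- The field of rational functions of the initial data. -/
abbrev RatField (N ν : ℕ) : Type := FractionRing (Poly N ν)

/-- The field of all algebraic functions of the initial data. -/
abbrev AlgField (N ν : ℕ) : Type := AlgebraicClosure (RatField N ν)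

/-- The variable `x`, regarded as an algebraic function. -/
def coord {N ν : ℕ} (x : Var N ν) : AlgField N ν :=
  algebraMap (RatField N ν) (AlgField N ν)
    (algebraMap (Poly N ν) (RatField N ν) (MvPolynomial.X x))

/-- Positions (lifted to the covering space) and velocities of all balls. -/
structure State (N ν : ℕ) where
  q : Fin N → Fin ν → AlgField N ν
  v : Fin N → Fin ν → AlgField N ν

/-- A symbolic collision sequence of length `n` together with its adjustment vectors: the
`k`-th collision takes place between the balls `i k` and `j k`, and the difference of their
lifted positions is to be corrected by the lattice vector `L • a k`. -/
structure CollisionScheme (N ν n : ℕ) where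
  i : Fin n → Fin N
  j : Fin n → Fin N
  ne : ∀ k, i k ≠ j k
  a : Fin n → Fin ν → ℤ

namespace CollisionScheme

variable {N ν n : ℕ}

/-- The relative position `q_i - q_j - L a` of the balls of the `k`-th collision. -/
def relPos (C : CollisionScheme N ν n) (k : Fin n) (s : State N ν) : Fin ν → AlgField N ν :=
  fun c => s.q (C.i k) c - s.q (C.j k) c - coord Var.size * (C.a k c : AlgField N ν)

/-- The relative velocity `v_i - v_j` of the balls of the `k`-th collision. -/
def relVel (C : CollisionScheme N ν n) (k : Fin n) (s : State N ν) : Fin ν → AlgField N ν :=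
  fun c => s.v (C.i k) c - s.v (C.j k) c

/-- Free motion during time `t`. -/
def flight (t : AlgField N ν) (s : State N ν) : State N ν where
  q := fun b c => s.q b c + t * s.v b c
  v := s.v

/-- The elastic collision number `k` of two balls of radius `r`: the total momentum of the two
balls is kept, and their relative velocity `w` becomes `w - (2 r²)⁻¹ ⟨w, u⟩ u`, where `u` is the
relative position (for `⟨u, u⟩ = (2 r)²` this is the reflection in the direction `u`). -/
def collide (C : CollisionScheme N ν n) (r : ℝ) (k : Fin n) (s : State N ν) : State N ν where
  q := s.q
  v := fun b c =>
    let M : AlgField N ν := coord (Var.mass (C.i k)) + coord (Var.mass (C.j k))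
    let J : AlgField N ν := algebraMap ℂ (AlgField N ν) ((1 / (2 * r ^ 2) : ℝ) : ℂ) *
      (C.relVel k s ⬝ᵥ C.relPos k s) * C.relPos k s c
    if b = C.i k then s.v b c - coord (Var.mass (C.j k)) / M * J
    else if b = C.j k then s.v b c + coord (Var.mass (C.i k)) / M * J
    else s.v b c

/-- `C.orbit r τ k` is the state right after the first `k` collisions, when `τ` lists the times
that elapse between consecutive collisions. The state number `0` is given by the variables. -/
def orbit (C : CollisionScheme N ν n) (r : ℝ) (τ : Fin n → AlgField N ν) : ℕ → State N ν
  | 0 => ⟨fun b c => coord (Var.pos b c), fun b c => coord (Var.vel b c)⟩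
  | k + 1 =>
    if h : k < n then C.collide r ⟨k, h⟩ (flight (τ ⟨k, h⟩) (C.orbit r τ k))
    else C.orbit r τ k

end CollisionScheme

/-- A discrete orbit structure for `N` balls of radius `r`: a symbolic collision sequence, the
adjustment vectors, and for each collision a root `τ k` of the quadratic equation saying that,
a time `τ k` after the previous collision, the two balls have distance `2 r`. If the quadratic
equation is irreducible over the field generated by the earlier data, its two roots are
conjugate; if it is reducible, the structure records which root is used. -/
structure OrbitStructure (N ν n : ℕ) (r : ℝ) extends CollisionScheme N ν n where
  τ : Fin n → AlgField N ν
  root : ∀ k : Fin n,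
    let w := toCollisionScheme.relVel k (toCollisionScheme.orbit r τ k)
    let u := toCollisionScheme.relPos k (toCollisionScheme.orbit r τ k)
    (w ⬝ᵥ w) * τ k ^ 2 + 2 * (w ⬝ᵥ u) * τ k +
      ((u ⬝ᵥ u) - algebraMap ℂ (AlgField N ν) ((4 * r ^ 2 : ℝ) : ℂ)) = 0

namespace OrbitStructure

variable {N ν n : ℕ} {r : ℝ}

/-- The velocities right after the first `k` collisions. -/
def V (S : OrbitStructure N ν n r) (k : ℕ) : Fin N → Fin ν → AlgField N ν :=
  (S.toCollisionScheme.orbit r S.τ k).v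

/-- A pair `(W, α)` of an infinitesimal translation `W` of the initial positions and of numbers
`α k` (the advances of the collisions) is encoded by `x`, with `W b c = x (inl (b, c))` and
`α k = x (inr k)`. Up to the collision `k`, the translation is transported into
`W k = W + ∑ l < k, α l • (V (l + 1) - V l)`. -/
def transported (S : OrbitStructure N ν n r) (x : (Fin N × Fin ν) ⊕ Fin n → AlgField N ν)
    (k : Fin n) (b : Fin N) (c : Fin ν) : AlgField N ν :=
  x (Sum.inl (b, c)) +
    ∑ l ∈ Finset.univ.filter (fun l : Fin n => l < k),
      x (Sum.inr l) * (S.V (l + 1) b c - S.V l b c)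

/-- The linear map whose kernel is the neutral space: `W` is neutral with advances `α` if and
only if, for every collision `k`, the vector `W k - α k • V k` lies in the generator space of
the collision cylinder, i.e. has equal components at the two colliding balls. -/
def neutralityMap (S : OrbitStructure N ν n r) :
    ((Fin N × Fin ν) ⊕ Fin n → AlgField N ν) →ₗ[AlgField N ν]
      (Fin n × Fin ν → AlgField N ν) where
  toFun x p :=
    (S.transported x p.1 (S.i p.1) p.2 - x (Sum.inr p.1) * S.V p.1 (S.i p.1) p.2) -
      (S.transported x p.1 (S.j p.1) p.2 - x (Sum.inr p.1) * S.V p.1 (S.j p.1) p.2)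
  map_add' x y := by
    funext p
    simp only [transported, Pi.add_apply, add_mul, Finset.sum_add_distrib]
    ring
  map_smul' t x := by
    funext p
    simp only [transported, Pi.smul_apply, smul_eq_mul, RingHom.id_apply, mul_assoc,
      ← Finset.mul_sum]
    ring

/-- The minors of order `ν N + n - (ν + 1)` of the system of neutrality equations. As its
solution space always contains the `ν` uniform translations and the direction of the flow, all
of these minors vanish if and only if the neutral space has a dimension greater than `ν + 1`,
which is the non-sufficiency of the orbit. -/
def minors (S : OrbitStructure N ν n r) : Set (AlgField N ν) :=
  {f | ∃ (row : Fin (ν * N + n - (ν + 1)) ↪ Fin n × Fin ν)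
      (col : Fin (ν * N + n - (ν + 1)) ↪ (Fin N × Fin ν) ⊕ Fin n),
    f = ((LinearMap.toMatrix' S.neutralityMap).submatrix row col).det}

/-- A finite system of algebraic functions that describes the non-sufficiency: it spans the same
complex vector space as the minors above (the list of these minors is one such system). -/
def IsNonSufficiencySystem (S : OrbitStructure N ν n r) {s : ℕ} (f : Fin s → AlgField N ν) :
    Prop :=
  Submodule.span ℂ (Set.range f) = Submodule.span ℂ S.minors

end OrbitStructure

/-- The product of all conjugates of the algebraic function `f` over the field of rational
functions, read off from the constant term of its minimal polynomial. -/
def conjProd {N ν : ℕ} (f : AlgField N ν) : RatField N ν :=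
  (-1) ^ (minpoly (RatField N ν) f).natDegree * (minpoly (RatField N ν) f).coeff 0

/-- The numerator, in lowest terms, of the product of all conjugates of `f`. For the functions
`f` of a non-sufficiency system these are the non-sufficiency polynomials. -/
def normNum {N ν : ℕ} (f : AlgField N ν) : Poly N ν :=
  IsFractionRing.num (Poly N ν) (conjProd f)

/-- The weight that counts the mass variables only. -/
def massWeight {N ν : ℕ} : Var N ν → ℕ
  | Var.mass _ => 1
  | _ => 0

/-- Homogeneity in the masses: all monomials of `P` have the same total degree in the mass
variables. -/
def HomogeneousInMasses {N ν : ℕ} (P : Poly N ν) : Prop :=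
  ∃ d : ℕ, MvPolynomial.IsWeightedHomogeneous massWeight P d

end HardBall

end

/-!
Let `A` be the field of the functions that are algebraic over the rational functions invariant under
the scaling of all masses. The equations of motion contain the masses only through the ratios
`m_i / (m_i + m_j)`, and every flight time is a root of a quadratic equation with leading
coefficient `⟨w, w⟩ ≠ 0`, so all data of the orbit, all minors and their linear combinations `f`
belong to `A`. The product of the conjugates of `f` is then a rational function that is algebraic
over the invariant ones, hence it has a finite orbit under the doubling of the masses and is fixed
by the multiplication of the masses by some `2 ^ k`, `k > 0`. Therefore this scaling multiplies its
numerator by a unit, which forces homogeneity. A homogeneous polynomial has only finitely many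
divisors up to units, and the scaling permutes them, so the same argument applies to a divisor.

For `⟨w, w⟩ ≠ 0` it suffices that the velocities after each collision are algebraically independent.
As the motion is reversible, the initial data are algebraic over the masses, the size of the torus,
the state after a collision and the first flight time. This is one element more than the
transcendence degree, but by the contact equation one of the position coordinates is algebraic over
the others; without it the remaining elements form a transcendence basis.
-/

noncomputable section

namespace HardBall

open MvPolynomial

theorem exists_associated_iterate_of_dvd {M : Type*} [CommMonoidWithZero M]
    [UniqueFactorizationMonoid M] (σ : M ≃* M) {p q : M} (hp : p ≠ 0)
    (hσ : Associated (σ p) p) (hq : q ∣ p) : ∃ k > 0, Associated (σ^[k] q) q := by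
  have hdvd : ∀ k, σ^[k] q ∣ p := fun k => by
    induction k with
    | zero => exact hq
    | succ k ih =>
      rw [Function.iterate_succ_apply']
      exact (map_dvd σ ih).trans hσ.dvd
  have hfin : {a | a ∣ Associates.mk p}.Finite :=
    @Set.toFinite _ _ <| @Finite.of_fintype _ <|
      UniqueFactorizationMonoid.fintypeSubtypeDvd _ (Associates.mk_ne_zero.2 hp)
  obtain ⟨a, b, hab, h⟩ := hfin.exists_lt_map_eq_of_forall_mem
    (f := fun k => Associates.mk (σ^[k] q)) fun k => Associates.mk_dvd_mk.2 (hdvd k)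
  refine ⟨b - a, Nat.sub_pos_of_lt hab, ?_⟩
  rw [Associates.mk_eq_mk_iff_associated, ← Nat.add_sub_of_le hab.le,
    Function.iterate_add_apply] at h
  have hcancel : ∀ (m : ℕ) {x y : M}, Associated (σ^[m] x) (σ^[m] y) → Associated x y := by
    intro m x y hxy
    induction m with
    | zero => exact hxy
    | succ m ih =>
      rw [Function.iterate_succ_apply', Function.iterate_succ_apply'] at hxy
      exact ih (by simpa only [MulEquiv.symm_apply_apply] using hxy.map σ.symm)
  exact (hcancel a h).symm

section WeightScale

variable {σ R : Type*} [CommRing R] (w : σ → ℕ)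

/-- The action of the units `t` of `R` on polynomials by the substitutions `x ↦ t ^ w x * x`, whose
eigenvectors are the weighted homogeneous polynomials. -/
def weightScale : Rˣ →* (MvPolynomial σ R ≃ₐ[R] MvPolynomial σ R) :=
  (AlgEquiv.algHomUnitsEquiv R (MvPolynomial σ R)).toMonoidHom.comp <| Units.map
    { toFun t := aeval fun x => t ^ w x • (X x : MvPolynomial σ R)
      map_one' := by ext; simp
      map_mul' s t := by ext; simp [mul_pow, smul_smul, mul_comm] }

theorem weightScale_eq_aeval (t : Rˣ) (p : MvPolynomial σ R) :
    weightScale w t p = aeval (fun x => (t : R) ^ w x • X x) p :=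
  rfl

theorem weightScale_X (t : Rˣ) (x : σ) :
    weightScale w t (X x : MvPolynomial σ R) = (t : R) ^ w x • X x := by
  rw [weightScale_eq_aeval, aeval_X]

theorem weightScale_monomial (t : Rˣ) (d : σ →₀ ℕ) (a : R) :
    weightScale w t (monomial d a) = (t : R) ^ Finsupp.weight w d • monomial d a := by
  simp only [monomial_eq, map_mul, map_finsuppProd, map_pow, weightScale_X, smul_pow, ← pow_mul]
  rw [weightScale_eq_aeval, aeval_C, algebraMap_eq, Finsupp.prod, Finsupp.prod, Finset.prod_smul,
    Finset.prod_pow_eq_pow_sum, Finsupp.weight_apply, mul_smul_comm]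
  simp only [Finsupp.sum, smul_eq_mul, mul_comm]

theorem coeff_weightScale (t : Rˣ) (p : MvPolynomial σ R) (d : σ →₀ ℕ) :
    (weightScale w t p).coeff d = (t : R) ^ Finsupp.weight w d * p.coeff d := by
  classical
  induction p using induction_on' with
  | add p q hp hq => rw [map_add, coeff_add, coeff_add, hp, hq, mul_add]
  | monomial e a =>
    rw [weightScale_monomial, coeff_smul, coeff_monomial, smul_eq_mul]
    split_ifs with h
    · rw [h]
    · rw [mul_zero, mul_zero]

variable {w}

theorem associated_weightScale {p : MvPolynomial σ R} {d : ℕ}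
    (h : IsWeightedHomogeneous w p d) (t : Rˣ) : Associated (weightScale w t p) p := by
  have hscale : weightScale w t p = C ((t ^ d : Rˣ) : R) * p := by
    ext e
    rw [coeff_weightScale, coeff_C_mul, Units.val_pow_eq_pow_val]
    by_cases he : p.coeff e = 0
    · rw [he, mul_zero, mul_zero]
    · rw [h he]
  rw [hscale]
  exact associated_unit_mul_left p _ ((t ^ d).isUnit.map C)

variable [IsDomain R] {t : Rˣ}

theorem exists_isWeightedHomogeneous_of_associated (ht : ¬ IsOfFinOrder t)
    {p : MvPolynomial σ R} (h : Associated (weightScale w t p) p) :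
    ∃ d, IsWeightedHomogeneous w p d := by
  obtain ⟨u, hu⟩ := h.symm
  obtain ⟨c, -, hc⟩ := isUnit_iff_eq_C_of_isReduced.1 u.isUnit
  have hpow : ∀ d, p.coeff d ≠ 0 → (t : R) ^ Finsupp.weight w d = c := fun d hd => by
    have := coeff_weightScale w t p d
    rw [← hu, hc, mul_comm p, coeff_C_mul] at this
    exact (mul_right_cancel₀ hd this).symm
  obtain rfl | hp := eq_or_ne p 0
  · exact ⟨0, isWeightedHomogeneous_zero R w 0⟩
  obtain ⟨e, he⟩ := ne_zero_iff.1 hp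
  refine ⟨Finsupp.weight w e, fun d hd => injective_pow_iff_not_isOfFinOrder.2 ht ?_⟩
  exact Units.ext (by simpa using (hpow d hd).trans (hpow e he).symm)

theorem exists_isWeightedHomogeneous_of_dvd [UniqueFactorizationMonoid R]
    (ht : ¬ IsOfFinOrder t) {p q : MvPolynomial σ R} (hp : p ≠ 0) {d : ℕ}
    (h : IsWeightedHomogeneous w p d) (hq : q ∣ p) : ∃ e, IsWeightedHomogeneous w q e := by
  obtain ⟨k, hk, hass⟩ := exists_associated_iterate_of_dvd
    (weightScale w t : MvPolynomial σ R ≃* MvPolynomial σ R) hp (associated_weightScale h t) hq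
  refine exists_isWeightedHomogeneous_of_associated (t := t ^ k) ?_ ?_
  · simpa [isOfFinOrder_pow, hk.ne'] using ht
  · rw [map_pow, AlgEquiv.coe_pow]
    exact hass

end WeightScale

theorem associated_num_map {A K : Type*} [CommRing A] [IsDomain A]
    [UniqueFactorizationMonoid A] [Field K] [Algebra A K] [IsFractionRing A K] (σ : A ≃+* A)
    {τ : K →+* K} (hτ : ∀ a, τ (algebraMap A K a) = algebraMap A K (σ a)) (x : K) :
    Associated (IsFractionRing.num A (τ x)) (σ (IsFractionRing.num A x)) := by
  have hrel : IsRelPrime (σ (IsFractionRing.num A x)) (σ (IsFractionRing.den A x)) :=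
    fun d hd hd' => by
      have h := IsFractionRing.num_den_reduced A x (d := σ.symm d)
        (by simpa using map_dvd σ.symm hd) (by simpa using map_dvd σ.symm hd')
      simpa using h.map σ
  have hden : σ (IsFractionRing.den A x) ∈ nonZeroDivisors A := by simp
  refine (IsFractionRing.num_den_unique A (τ x) _ ⟨_, hden⟩ hrel ?_).1
  rw [IsFractionRing.mk'_eq_div, ← hτ, ← hτ, ← map_div₀, IsFractionRing.mk'_num_den']

theorem mem_periodicPts_of_isAlgebraic {F K : Type*} [Field F] [Field K] [Algebra F K]
    (σ : K →ₐ[F] K) {x : K} (hx : IsAlgebraic F x) : x ∈ Function.periodicPts σ := by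
  obtain ⟨p, hp, hpx⟩ := hx
  have hmaps : Set.MapsTo σ (p.rootSet K) (p.rootSet K) := Polynomial.rootSet_mapsTo σ
  have hinj : Function.Injective (hmaps.restrict σ _ _) := hmaps.restrict_inj.2 σ.injective.injOn
  obtain ⟨k, hk, h⟩ := hinj.mem_periodicPts ⟨x, Polynomial.mem_rootSet.2 ⟨hp, hpx⟩⟩
  rw [Function.IsPeriodicPt, hmaps.iterate_restrict] at h
  exact ⟨k, hk, congrArg Subtype.val h⟩

theorem minpoly_coeff_isAlgebraic {F K E : Type*} [Field F] [Field K] [Field E] [Algebra F K]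
    [Algebra K E] [Algebra F E] [IsScalarTower F K E] {x : E} (hx : IsAlgebraic F x) (i : ℕ) :
    IsAlgebraic F ((minpoly K x).coeff i) := by
  have h_int := hx.isIntegral
  have hlifts := integralClosure.mem_lifts_of_monic_of_dvd_map K (minpoly.monic h_int)
    (minpoly.monic h_int.tower_top) (minpoly.dvd_map_of_isScalarTower F K x)
  obtain ⟨a, ha⟩ := Polynomial.lifts_iff_coeff_lifts _ |>.1 hlifts i
  exact ha ▸ IsIntegral.isAlgebraic a.2

section RelativelyAlgebraicallyClosed

variable {F E : Type*} [Field F] [Field E] [Algebra F E] {A : IntermediateField F E}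

theorem mem_of_quadratic [IsIntegrallyClosedIn A E] {a b c t : E}
    (ha : a ∈ A) (hb : b ∈ A) (hc : c ∈ A) (ha0 : a ≠ 0) (h : a * t ^ 2 + b * t + c = 0) :
    t ∈ A := by
  let p : Polynomial A := Polynomial.C ⟨a, ha⟩ * Polynomial.X ^ 2 +
    Polynomial.C ⟨b, hb⟩ * Polynomial.X + Polynomial.C ⟨c, hc⟩
  have hp : p ≠ 0 := Polynomial.ne_zero_of_degree_gt (n := 1) <| by
    rw [Polynomial.degree_quadratic fun h0 => ha0 (congrArg Subtype.val h0)]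
    exact Nat.one_lt_ofNat
  have hroot : Polynomial.aeval t p = 0 := by
    simp only [p, map_add, map_mul, map_pow, Polynomial.aeval_C, Polynomial.aeval_X]
    exact h
  exact Subring.isIntegrallyClosedIn_iff.1 ‹_› (IsAlgebraic.isIntegral ⟨p, hp, hroot⟩)

variable {ι : Type*} [Fintype ι]

theorem dotProduct_mem {u w : ι → E} (hu : ∀ c, u c ∈ A) (hw : ∀ c, w c ∈ A) : u ⬝ᵥ w ∈ A :=
  sum_mem fun c _ => mul_mem (hu c) (hw c)

theorem mem_of_dotProduct_self_mem [IsIntegrallyClosedIn A E] {u : ι → E} {c₀ : ι}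
    (h : u ⬝ᵥ u ∈ A) (hu : ∀ c, c ≠ c₀ → u c ∈ A) : u c₀ ∈ A := by
  classical
  rw [dotProduct, ← Finset.add_sum_erase _ _ (Finset.mem_univ c₀)] at h
  have hrest : ∑ c ∈ Finset.univ.erase c₀, u c * u c ∈ A := sum_mem fun c hc =>
    have hc := hu c (Finset.ne_of_mem_erase hc)
    mul_mem hc hc
  have hsq : u c₀ ^ 2 ∈ A := by
    simpa only [add_sub_cancel_right, ← sq] using sub_mem h hrest
  refine Subring.isIntegrallyClosedIn_iff.1 ‹_› (IsIntegral.of_pow two_pos ?_)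
  exact isIntegral_algebraMap (A := E) (x := (⟨_, hsq⟩ : A))

end RelativelyAlgebraicallyClosed

section AlgebraicIndependence

variable {F E ι : Type*} [Field F] [Field E] [Algebra F E]

instance isIntegrallyClosedIn_algebraicClosure (K : Type*) [Field K] [Algebra F K] [Algebra K E]
    [IsScalarTower F K E] : IsIntegrallyClosedIn ((algebraicClosure K E).restrictScalars F) E :=
  Subring.isIntegrallyClosedIn_iff.2 fun x hx =>
    have hx : IsAlgebraic (algebraicClosure K E) x := hx.isAlgebraic
    mem_algebraicClosure_iff.2 (hx.restrictScalars K)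

theorem algebraicIndependent_of_forall_mem [Finite ι] {b : ι → E} (hb : IsTranscendenceBasis F b)
    {y : ι → E} (h : ∀ A : IntermediateField F E, IsIntegrallyClosedIn A E → (∀ x, y x ∈ A) →
      ∀ x, b x ∈ A) : AlgebraicIndependent F y := by
  let K := IntermediateField.adjoin F (Set.range y)
  have hyK : ∀ x, y x ∈ algebraicClosure K E := fun x =>
    algebraMap_mem _ (⟨y x, IntermediateField.subset_adjoin _ _ ⟨x, rfl⟩⟩ : K)
  have hK : Algebra.IsAlgebraic K E := hb.isAlgebraic_iff.2 fun x =>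
    mem_algebraicClosure_iff.1 (h ((algebraicClosure K E).restrictScalars F) inferInstance hyK x)
  have := IntermediateField.isAlgebraic_adjoin_iff_top.1 hK
  exact (Algebra.IsAlgebraic.isTranscendenceBasis_of_lift_le_trdeg_of_finite F y
    hb.lift_cardinalMk_eq_trdeg.le).1

theorem dotProduct_self_sub_ne_zero {κ : Type*} [Fintype κ] [Nonempty κ] {y : ι → E}
    (hy : AlgebraicIndependent F y) {a b : κ → ι} (ha : Function.Injective a)
    (hab : ∀ c d, b c ≠ a d) :
    (fun c => y (a c) - y (b c)) ⬝ᵥ (fun c => y (a c) - y (b c)) ≠ 0 := by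
  classical
  intro h
  have h0 : (∑ c, (X (a c) - X (b c)) * (X (a c) - X (b c)) : MvPolynomial ι F) = 0 :=
    hy (by simpa only [map_zero, map_sum, map_mul, map_sub, aeval_X, dotProduct] using h)
  obtain ⟨d⟩ := ‹Nonempty κ›
  have heval := congrArg (MvPolynomial.eval fun x => if x = a d then (1 : F) else 0) h0
  simp [hab, ha.eq_iff] at heval

end AlgebraicIndependence

variable {N ν n : ℕ}

instance : Finite (Var N ν) := by
  refine Finite.of_injective (β := (Fin N × Fin ν) ⊕ (Fin N × Fin ν) ⊕ Fin N ⊕ Unit)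
    (fun
      | .pos i c => .inl (i, c)
      | .vel i c => .inr (.inl (i, c))
      | .mass i => .inr (.inr (.inl i))
      | .size => .inr (.inr (.inr ()))) ?_
  rintro (_ | _ | _ | _) (_ | _ | _ | _) h <;> simp_all

theorem isTranscendenceBasis_coord :
    IsTranscendenceBasis ℂ (coord : Var N ν → AlgField N ν) :=
  have := IsLocalization.isAlgebraic (RatField N ν) (nonZeroDivisors (Poly N ν))
  have h : IsTranscendenceBasis ℂ (algebraMap (Poly N ν) (RatField N ν) ∘ X) :=
    (IsTranscendenceBasis.mvPolynomial (Var N ν) ℂ).algebraMap_comp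
  h.algebraMap_comp

/-- The share `m_i / (m_i + m_j)` of the ball `i` in the total mass of the balls `i` and `j`. -/
def massRatio (i j : Fin N) : AlgField N ν :=
  coord (Var.mass i) / (coord (Var.mass i) + coord (Var.mass j))

theorem massRatio_add_massRatio {i j : Fin N} (hij : i ≠ j) :
    (massRatio i j + massRatio j i : AlgField N ν) = 1 := by
  classical
  have hne : (coord (Var.mass i) + coord (Var.mass j) : AlgField N ν) ≠ 0 := fun h => by
    have h0 : (X (Var.mass i) + X (Var.mass j) : Poly N ν) = 0 :=
      isTranscendenceBasis_coord.1 (by simpa only [map_zero, map_add, aeval_X] using h)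
    have := congrArg (MvPolynomial.eval fun x => if x = Var.mass i then (1 : ℂ) else 0) h0
    simp [hij.symm] at this
  rw [massRatio, massRatio, add_comm (coord (Var.mass j)), ← add_div, div_self hne]

/-- All positions and velocities are elements of the field `A`. -/
structure State.DefinedOver (A : IntermediateField ℂ (AlgField N ν)) (s : State N ν) : Prop where
  q_mem : ∀ b c, s.q b c ∈ A
  v_mem : ∀ b c, s.v b c ∈ A

/-- The field `A` contains the coefficients of the equations of motion, in which the masses occur
only through their ratios. -/
structure ContainsParameters (A : IntermediateField ℂ (AlgField N ν)) : Prop where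
  size_mem : coord Var.size ∈ A
  massRatio_mem : ∀ i j, massRatio i j ∈ A

theorem ContainsParameters.of_mass_mem {A : IntermediateField ℂ (AlgField N ν)}
    (hL : coord Var.size ∈ A) (hm : ∀ i, coord (Var.mass i) ∈ A) : ContainsParameters A :=
  ⟨hL, fun i j => div_mem (hm i) (add_mem (hm i) (hm j))⟩

namespace CollisionScheme

theorem relVel_sq_ne_zero_of_algebraicIndependent [Nonempty (Fin ν)]
    (C : CollisionScheme N ν n) {s : State N ν} {y : Var N ν → AlgField N ν}
    (hy : AlgebraicIndependent ℂ y) (hv : ∀ b c, y (.vel b c) = s.v b c) (k : Fin n) :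
    C.relVel k s ⬝ᵥ C.relVel k s ≠ 0 := by
  have h := dotProduct_self_sub_ne_zero (a := Var.vel (C.i k)) (b := Var.vel (C.j k)) hy
    (fun _ _ hc => (Var.vel.inj hc).2) fun _ _ hc => C.ne k (Var.vel.inj hc).1.symm
  simp only [hv] at h
  exact h

section Flight

variable (t : AlgField N ν) (s : State N ν)

theorem flight_neg_flight : flight (-t) (flight t s) = s := by
  simp [flight]

variable (C : CollisionScheme N ν n) (k : Fin n)

theorem relPos_flight : C.relPos k (flight t s) = C.relPos k s + t • C.relVel k s := by
  funext c
  simp only [relPos, flight, relVel, Pi.add_apply, Pi.smul_apply, smul_eq_mul]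
  ring

theorem relPos_flight_sq : C.relPos k (flight t s) ⬝ᵥ C.relPos k (flight t s) =
    (C.relVel k s ⬝ᵥ C.relVel k s) * t ^ 2 + 2 * (C.relVel k s ⬝ᵥ C.relPos k s) * t +
      C.relPos k s ⬝ᵥ C.relPos k s := by
  rw [relPos_flight]
  simp only [add_dotProduct, dotProduct_add, smul_dotProduct, dotProduct_smul, smul_eq_mul,
    dotProduct_comm (C.relPos k s) (C.relVel k s)]
  ring

theorem orbit_succ (r : ℝ) (τ : Fin n → AlgField N ν) :
    C.orbit r τ (k + 1) = C.collide r k (flight (τ k) (C.orbit r τ k)) := by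
  simp [orbit]

end Flight

section Collision

variable (C : CollisionScheme N ν n) (r : ℝ) (k : Fin n) (s : State N ν)

/-- The relative velocity lost in the `k`-th collision, which is also the momentum transfer divided
by the reduced mass of the two balls. -/
def impulse : Fin ν → AlgField N ν :=
  (algebraMap ℂ (AlgField N ν) ((1 / (2 * r ^ 2) : ℝ) : ℂ) * (C.relVel k s ⬝ᵥ C.relPos k s)) •
    C.relPos k s

theorem collide_v (b : Fin N) (c : Fin ν) : (C.collide r k s).v b c =
    if b = C.i k then s.v b c - massRatio (C.j k) (C.i k) * C.impulse r k s c
    else if b = C.j k then s.v b c + massRatio (C.i k) (C.j k) * C.impulse r k s c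
    else s.v b c := by
  rw [massRatio, add_comm (coord (Var.mass (C.j k)))]
  rfl

theorem relVel_collide : C.relVel k (C.collide r k s) = C.relVel k s - C.impulse r k s := by
  funext c
  have h := massRatio_add_massRatio (ν := ν) (C.ne k)
  rw [relVel, collide_v, collide_v, if_pos rfl, if_neg (C.ne k).symm, if_pos rfl, Pi.sub_apply,
    relVel]
  linear_combination -C.impulse r k s c * h

variable {r k s}

theorem relVel_collide_dotProduct_relPos (hr : r ≠ 0)
    (hu : C.relPos k s ⬝ᵥ C.relPos k s = algebraMap ℂ (AlgField N ν) ((4 * r ^ 2 : ℝ) : ℂ)) :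
    C.relVel k (C.collide r k s) ⬝ᵥ C.relPos k s = -(C.relVel k s ⬝ᵥ C.relPos k s) := by
  have hr2 : algebraMap ℂ (AlgField N ν) ((1 / (2 * r ^ 2) : ℝ) : ℂ) *
      algebraMap ℂ (AlgField N ν) ((4 * r ^ 2 : ℝ) : ℂ) = 2 := by
    rw [← map_mul, ← Complex.ofReal_mul,
      show 1 / (2 * r ^ 2) * (4 * r ^ 2) = 2 by field_simp; norm_num,
      Complex.ofReal_ofNat, map_ofNat]
  rw [relVel_collide, sub_dotProduct, impulse, smul_dotProduct, hu, smul_eq_mul, mul_right_comm,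
    hr2]
  ring

end Collision

section DefinedOver

variable (C : CollisionScheme N ν n) {A : IntermediateField ℂ (AlgField N ν)} {r : ℝ} {k : Fin n}
  {t : AlgField N ν} {s : State N ν}

theorem relPos_mem (hL : coord Var.size ∈ A) (hs : s.DefinedOver A) (c : Fin ν) :
    C.relPos k s c ∈ A :=
  sub_mem (sub_mem (hs.q_mem _ _) (hs.q_mem _ _)) (mul_mem hL (intCast_mem _ _))

theorem relVel_mem (hs : s.DefinedOver A) (c : Fin ν) : C.relVel k s c ∈ A :=
  sub_mem (hs.v_mem _ _) (hs.v_mem _ _)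

theorem definedOver_flight (ht : t ∈ A) (hs : s.DefinedOver A) : (flight t s).DefinedOver A :=
  ⟨fun b c => add_mem (hs.q_mem b c) (mul_mem ht (hs.v_mem b c)), hs.v_mem⟩

theorem definedOver_of_flight (ht : t ∈ A) (hs : (flight t s).DefinedOver A) :
    s.DefinedOver A :=
  flight_neg_flight t s ▸ definedOver_flight (neg_mem ht) hs

theorem flightTime_mem [IsIntegrallyClosedIn A (AlgField N ν)] (hL : coord Var.size ∈ A)
    (hw : C.relVel k s ⬝ᵥ C.relVel k s ≠ 0) (hs : s.DefinedOver A)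
    (hu : C.relPos k (flight t s) ⬝ᵥ C.relPos k (flight t s) ∈ A) : t ∈ A := by
  have hw_mem := C.relVel_mem (k := k) hs
  have hu_mem := C.relPos_mem (k := k) hL hs
  refine mem_of_quadratic (dotProduct_mem hw_mem hw_mem)
    (mul_mem (ofNat_mem A 2) (dotProduct_mem hw_mem hu_mem))
    (sub_mem (dotProduct_mem hu_mem hu_mem) hu) hw ?_
  rw [relPos_flight_sq]
  ring

theorem flightTime_mem_of_flight [IsIntegrallyClosedIn A (AlgField N ν)]
    (hL : coord Var.size ∈ A) (hw : C.relVel k s ⬝ᵥ C.relVel k s ≠ 0)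
    (hu : C.relPos k s ⬝ᵥ C.relPos k s ∈ A) (hs : (flight t s).DefinedOver A) : t ∈ A := by
  rw [← flight_neg_flight t s] at hu
  exact neg_mem_iff.1 (C.flightTime_mem (s := flight t s) hL hw hs hu)

theorem definedOver_collide_iff (hA : ContainsParameters A)
    (hJ : ∀ c, C.impulse r k s c ∈ A) : (C.collide r k s).DefinedOver A ↔ s.DefinedOver A := by
  have hv : ∀ b c, (C.collide r k s).v b c ∈ A ↔ s.v b c ∈ A := fun b c => by
    rw [collide_v]
    split_ifs
    · rw [sub_eq_add_neg]
      exact add_mem_cancel_right (neg_mem (mul_mem (hA.massRatio_mem _ _) (hJ c)))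
    · exact add_mem_cancel_right (mul_mem (hA.massRatio_mem _ _) (hJ c))
    · rfl
  exact ⟨fun h => ⟨h.q_mem, fun b c => (hv b c).1 (h.v_mem b c)⟩,
    fun h => ⟨h.q_mem, fun b c => (hv b c).2 (h.v_mem b c)⟩⟩

theorem impulse_mem (hu : ∀ c, C.relPos k s c ∈ A) (hwu : C.relVel k s ⬝ᵥ C.relPos k s ∈ A)
    (c : Fin ν) : C.impulse r k s c ∈ A :=
  mul_mem (mul_mem (A.algebraMap_mem _) hwu) (hu c)

theorem definedOver_collide (hA : ContainsParameters A) (hs : s.DefinedOver A) :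
    (C.collide r k s).DefinedOver A :=
  have hu := C.relPos_mem hA.size_mem hs
  (C.definedOver_collide_iff hA (C.impulse_mem hu (dotProduct_mem (C.relVel_mem hs) hu))).2 hs

theorem definedOver_of_collide (hA : ContainsParameters A) (hr : r ≠ 0)
    (hu : C.relPos k s ⬝ᵥ C.relPos k s = algebraMap ℂ (AlgField N ν) ((4 * r ^ 2 : ℝ) : ℂ))
    (hs : (C.collide r k s).DefinedOver A) : s.DefinedOver A := by
  have hu_mem : ∀ c, C.relPos k s c ∈ A := C.relPos_mem (s := C.collide r k s) hA.size_mem hs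
  have hwu := dotProduct_mem (C.relVel_mem (k := k) hs) hu_mem
  rw [C.relVel_collide_dotProduct_relPos hr hu, neg_mem_iff] at hwu
  exact (C.definedOver_collide_iff hA (C.impulse_mem hu_mem hwu)).1 hs

end DefinedOver

end CollisionScheme

namespace OrbitStructure

variable {r : ℝ} (S : OrbitStructure N ν n r)

/-- The state right after the first `k` collisions. -/
abbrev state (k : ℕ) : State N ν :=
  S.orbit r S.τ k

/-- The state right before the collision `k`. -/
abbrev preState (k : Fin n) : State N ν :=
  CollisionScheme.flight (S.τ k) (S.state k)

theorem state_succ (k : Fin n) : S.state (k + 1) = S.collide r k (S.preState k) :=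
  S.orbit_succ k r S.τ

theorem relPos_preState_sq (k : Fin n) : S.relPos k (S.preState k) ⬝ᵥ S.relPos k (S.preState k) =
    algebraMap ℂ (AlgField N ν) ((4 * r ^ 2 : ℝ) : ℂ) := by
  have h := S.root k
  rw [CollisionScheme.relPos_flight_sq]
  linear_combination h

theorem relPos_state_succ_sq (k : Fin n) :
    S.relPos k (S.state (k + 1)) ⬝ᵥ S.relPos k (S.state (k + 1)) =
      algebraMap ℂ (AlgField N ν) ((4 * r ^ 2 : ℝ) : ℂ) := by
  rw [state_succ]
  exact S.relPos_preState_sq k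

theorem nonempty_fin (S : OrbitStructure N ν n r) (hr : r ≠ 0) (k : Fin n) :
    Nonempty (Fin ν) := by
  by_contra hν
  rw [not_nonempty_iff] at hν
  have h := S.relPos_preState_sq k
  rw [dotProduct, Finset.univ_eq_empty, Finset.sum_empty, eq_comm, map_eq_zero] at h
  exact mul_ne_zero four_ne_zero (pow_ne_zero 2 hr) (Complex.ofReal_eq_zero.1 h)

section Reversibility

/-- The initial data are algebraic over the masses, the size of the torus, the state after the
first `k` collisions and the first flight time: every relatively algebraically closed field that
contains the latter contains the former. The first flight time has to be included because nothing
else in the later states tells when the motion started. -/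
def DeterminesInitialData (k : ℕ) : Prop :=
  ∀ A : IntermediateField ℂ (AlgField N ν), IsIntegrallyClosedIn A (AlgField N ν) →
    coord Var.size ∈ A → (∀ i, coord (Var.mass i) ∈ A) → (∀ l : Fin n, (l : ℕ) = 0 → S.τ l ∈ A) →
      (S.state k).DefinedOver A → ∀ x, coord x ∈ A

theorem determinesInitialData_zero : S.DeterminesInitialData 0 := by
  rintro A - hL hm - hs (_ | _ | _ | _)
  exacts [hs.q_mem _ _, hs.v_mem _ _, hm _, hL]

/-- The coordinates of the state after the collision `k`, the masses and the size of the torus,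
except that the coordinate `c₀` of the position of one of the two colliding balls, which is
algebraic over the others by the contact equation, is replaced by the first flight time. -/
def contactCoords (k : Fin n) (c₀ : Fin ν) : Var N ν → AlgField N ν
  | .pos b c => if b = S.i k ∧ c = c₀ then S.τ ⟨0, k.pos⟩ else (S.state (k + 1)).q b c
  | .vel b c => (S.state (k + 1)).v b c
  | .mass b => coord (.mass b)
  | .size => coord .size

variable {S} {A : IntermediateField ℂ (AlgField N ν)} {k : Fin n} {c₀ : Fin ν}

theorem definedOver_of_contactCoords_mem [IsIntegrallyClosedIn A (AlgField N ν)]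
    (h : ∀ x, S.contactCoords k c₀ x ∈ A) : (S.state (k + 1)).DefinedOver A := by
  have hL : coord Var.size ∈ A := h .size
  have hq : ∀ b c, ¬ (b = S.i k ∧ c = c₀) → (S.state (k + 1)).q b c ∈ A := fun b c hbc => by
    simpa only [contactCoords, if_neg hbc] using h (.pos b c)
  have hqj : ∀ c, (S.state (k + 1)).q (S.j k) c ∈ A := fun c => hq _ _ fun hb => S.ne k hb.1.symm
  have ha : ∀ c, coord Var.size * (S.a k c : AlgField N ν) ∈ A := fun c =>
    mul_mem hL (intCast_mem _ _)
  have hu : S.relPos k (S.state (k + 1)) c₀ ∈ A := by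
    refine mem_of_dotProduct_self_mem ?_ fun c hc =>
      sub_mem (sub_mem (hq _ _ fun hb => hc hb.2) (hqj c)) (ha c)
    rw [relPos_state_succ_sq]
    exact A.algebraMap_mem _
  refine ⟨fun b c => ?_, fun b c => h (.vel b c)⟩
  by_cases hbc : b = S.i k ∧ c = c₀
  · rw [hbc.1, hbc.2]
    simpa only [CollisionScheme.relPos, sub_add_cancel] using
      add_mem (add_mem hu (ha c₀)) (hqj c₀)
  · exact hq b c hbc

theorem algebraicIndependent_contactCoords (h : S.DeterminesInitialData (k + 1)) (c₀ : Fin ν) :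
    AlgebraicIndependent ℂ (S.contactCoords k c₀) := by
  refine algebraicIndependent_of_forall_mem isTranscendenceBasis_coord fun A hA hy => ?_
  refine h A hA (hy .size) (fun i => hy (.mass i)) (fun l hl => ?_)
    (definedOver_of_contactCoords_mem hy)
  have hτ := hy (.pos (S.i k) c₀)
  simp only [contactCoords, and_self, if_true] at hτ
  rwa [show l = ⟨0, k.pos⟩ from Fin.ext hl]

theorem relVel_sq_ne_zero_of_determinesInitialData (hr : r ≠ 0)
    (h : S.DeterminesInitialData (k + 1)) (l : Fin n) :
    S.relVel l (S.state (k + 1)) ⬝ᵥ S.relVel l (S.state (k + 1)) ≠ 0 := by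
  have := S.nonempty_fin hr k
  exact S.relVel_sq_ne_zero_of_algebraicIndependent
    (algebraicIndependent_contactCoords h this.some) (fun _ _ => rfl) l

variable (S)

theorem determinesInitialData (hr : r ≠ 0) {k : ℕ} (hk : k ≤ n) : S.DeterminesInitialData k := by
  induction k with
  | zero => exact S.determinesInitialData_zero
  | succ k ih =>
    intro A hA hL hm hτ₀ hs
    have hpre : (S.preState ⟨k, hk⟩).DefinedOver A :=
      S.definedOver_of_collide (.of_mass_mem hL hm) hr (S.relPos_preState_sq _)
        (S.state_succ ⟨k, hk⟩ ▸ hs)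
    suffices hτ : S.τ ⟨k, hk⟩ ∈ A from
      ih (Nat.le_of_succ_le hk) A hA hL hm hτ₀ (CollisionScheme.definedOver_of_flight hτ hpre)
    cases k with
    | zero => exact hτ₀ _ rfl
    | succ j =>
      let j' : Fin n := ⟨j, (Nat.lt_succ_self j).trans hk⟩
      -- The flight starts where the balls of the previous collision are in contact.
      have hcontact := S.relPos_state_succ_sq j'
      exact S.flightTime_mem_of_flight hL
        (relVel_sq_ne_zero_of_determinesInitialData (k := j') hr (ih (Nat.le_of_succ_le hk)) j')
        (hcontact ▸ A.algebraMap_mem _) hpre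

theorem relVel_sq_ne_zero (hr : r ≠ 0) (k : Fin n) :
    S.relVel k (S.state k) ⬝ᵥ S.relVel k (S.state k) ≠ 0 := by
  obtain ⟨_ | j, hk⟩ := k
  · have := S.nonempty_fin hr ⟨0, hk⟩
    exact S.relVel_sq_ne_zero_of_algebraicIndependent isTranscendenceBasis_coord.1
      (fun _ _ => rfl) ⟨0, hk⟩
  · exact relVel_sq_ne_zero_of_determinesInitialData (k := ⟨j, (Nat.lt_succ_self j).trans hk⟩) hr
      (S.determinesInitialData hr hk.le) ⟨j + 1, hk⟩

end Reversibility

section DefinedOver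

variable {S} {A : IntermediateField ℂ (AlgField N ν)}

theorem definedOver_state [IsIntegrallyClosedIn A (AlgField N ν)] (hr : r ≠ 0)
    (hA : ContainsParameters A) (h₀ : (S.state 0).DefinedOver A) (k : ℕ) :
    (S.state k).DefinedOver A := by
  induction k with
  | zero => exact h₀
  | succ k ih =>
    by_cases hk : k < n
    · have hτ : S.τ ⟨k, hk⟩ ∈ A :=
        S.flightTime_mem hA.size_mem (S.relVel_sq_ne_zero hr ⟨k, hk⟩) ih
          (S.relPos_preState_sq ⟨k, hk⟩ ▸ A.algebraMap_mem _)
      rw [S.state_succ ⟨k, hk⟩]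
      exact S.definedOver_collide hA (CollisionScheme.definedOver_flight hτ ih)
    · rwa [state, CollisionScheme.orbit, dif_neg hk]

theorem transported_mem (hV : ∀ k b c, S.V k b c ∈ A)
    {x : (Fin N × Fin ν) ⊕ Fin n → AlgField N ν} (hx : ∀ y, x y ∈ A) (k : Fin n) (b : Fin N)
    (c : Fin ν) : S.transported x k b c ∈ A :=
  add_mem (hx _) (sum_mem fun _ _ => mul_mem (hx _) (sub_mem (hV _ _ _) (hV _ _ _)))

theorem toMatrix'_neutralityMap_mem (hV : ∀ k b c, S.V k b c ∈ A) (row : Fin n × Fin ν)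
    (col : (Fin N × Fin ν) ⊕ Fin n) : LinearMap.toMatrix' S.neutralityMap row col ∈ A := by
  have hx : ∀ y, (Pi.single col 1 : _ → AlgField N ν) y ∈ A := fun y => by
    rw [Pi.single_apply]
    split_ifs
    exacts [one_mem A, zero_mem A]
  rw [LinearMap.toMatrix'_apply]
  exact sub_mem (sub_mem (transported_mem hV hx _ _ _) (mul_mem (hx _) (hV _ _ _)))
    (sub_mem (transported_mem hV hx _ _ _) (mul_mem (hx _) (hV _ _ _)))

theorem minors_subset (hV : ∀ k b c, S.V k b c ∈ A) : S.minors ⊆ A := by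
  rintro _ ⟨row, col, rfl⟩
  rw [Matrix.det_apply]
  exact sum_mem fun _ _ => zsmul_mem (prod_mem fun _ _ => toMatrix'_neutralityMap_mem hV _ _) _

end DefinedOver

end OrbitStructure

section MassScaling

open IntermediateField

/-- The multiplication of all masses by `t`, as an automorphism of the field of rational
functions of the initial data. -/
def massScale : ℂˣ →* Gal(RatField N ν/ℂ) :=
  (IsFractionRing.fieldEquivOfAlgEquivHom (B := Poly N ν) ℂ (RatField N ν)).comp
    (weightScale massWeight)

theorem massScale_algebraMap (t : ℂˣ) (p : Poly N ν) :
    massScale t (algebraMap (Poly N ν) (RatField N ν) p) =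
      algebraMap (Poly N ν) (RatField N ν) (weightScale massWeight t p) :=
  IsFractionRing.fieldEquivOfAlgEquiv_algebraMap ℂ (RatField N ν) (RatField N ν)
    (weightScale massWeight t) p

theorem associated_num_massScale (t : ℂˣ) (x : RatField N ν) :
    Associated (IsFractionRing.num (Poly N ν) (massScale t x))
      (weightScale massWeight t (IsFractionRing.num (Poly N ν) x)) :=
  associated_num_map (weightScale massWeight t).toRingEquiv
    (τ := (massScale t).toAlgHom.toRingHom) (massScale_algebraMap t) x

variable (N ν) in
/-- The rational functions that do not change when all masses are multiplied by the same number. -/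
abbrev massScaleInvariants : IntermediateField ℂ (RatField N ν) :=
  fixedField (massScale (N := N) (ν := ν)).range

variable (N ν) in
/-- The functions that are algebraic over the rational functions invariant under the scaling of
the masses. The scaling itself does not act on algebraic functions. -/
abbrev algebraicMassScaleInvariants : IntermediateField ℂ (AlgField N ν) :=
  (algebraicClosure (massScaleInvariants N ν) (AlgField N ν)).restrictScalars ℂ

theorem algebraMap_mem_algebraicMassScaleInvariants {x : RatField N ν}
    (hx : ∀ t, massScale t x = x) :
    algebraMap (RatField N ν) (AlgField N ν) x ∈ algebraicMassScaleInvariants N ν := by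
  have hx : x ∈ massScaleInvariants N ν :=
    (mem_fixedField_iff _ _).2 (by rintro _ ⟨t, rfl⟩; exact hx t)
  exact (algebraicClosure (massScaleInvariants N ν) (AlgField N ν)).algebraMap_mem ⟨x, hx⟩

theorem coord_mem_algebraicMassScaleInvariants {x : Var N ν} (hx : massWeight x = 0) :
    coord x ∈ algebraicMassScaleInvariants N ν :=
  algebraMap_mem_algebraicMassScaleInvariants fun t => by
    rw [massScale_algebraMap, weightScale_X, hx, pow_zero, one_smul]

theorem massRatio_mem_algebraicMassScaleInvariants (i j : Fin N) :
    massRatio i j ∈ algebraicMassScaleInvariants N ν := by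
  rw [massRatio, coord, coord, ← map_add, ← map_div₀]
  refine algebraMap_mem_algebraicMassScaleInvariants fun t => ?_
  simp only [map_div₀, map_add, massScale_algebraMap, weightScale_X, massWeight, pow_one]
  rw [← map_add, ← smul_add, Algebra.smul_def, Algebra.smul_def, map_mul, map_mul, map_add,
    mul_div_mul_left]
  simp

theorem containsParameters_algebraicMassScaleInvariants :
    ContainsParameters (algebraicMassScaleInvariants N ν) :=
  ⟨coord_mem_algebraicMassScaleInvariants rfl, massRatio_mem_algebraicMassScaleInvariants⟩

theorem OrbitStructure.minors_subset_algebraicMassScaleInvariants {r : ℝ} (hr : r ≠ 0)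
    (S : OrbitStructure N ν n r) : S.minors ⊆ algebraicMassScaleInvariants N ν :=
  minors_subset fun k => (definedOver_state hr containsParameters_algebraicMassScaleInvariants
    ⟨fun _ _ => coord_mem_algebraicMassScaleInvariants rfl,
      fun _ _ => coord_mem_algebraicMassScaleInvariants rfl⟩ k).v_mem

theorem isAlgebraic_conjProd {f : AlgField N ν} (hf : f ∈ algebraicMassScaleInvariants N ν) :
    IsAlgebraic (massScaleInvariants N ν) (conjProd f) :=
  (isAlgebraic_one.neg.pow _).mul
    (minpoly_coeff_isAlgebraic (mem_algebraicClosure_iff.1 hf) 0)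

theorem exists_massScale_pow_eq {x : RatField N ν} (hx : IsAlgebraic (massScaleInvariants N ν) x)
    (t : ℂˣ) : ∃ k > 0, massScale (t ^ k) x = x := by
  have ht : massScale t ∈ fixingSubgroup (massScaleInvariants N ν) :=
    (le_iff_le _ _).1 le_rfl ⟨t, rfl⟩
  obtain ⟨k, hk, h⟩ := mem_periodicPts_of_isAlgebraic
    (fixingSubgroupEquiv _ ⟨massScale t, ht⟩).toAlgHom hx
  refine ⟨k, hk, ?_⟩
  rw [map_pow, AlgEquiv.coe_pow]
  exact h

theorem exists_not_isOfFinOrder : ∃ t : ℂˣ, ¬ IsOfFinOrder t :=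
  ⟨Units.mk0 2 two_ne_zero, fun h => by simpa using (Units.coeHom ℂ).isOfFinOrder h |>.norm_eq_one⟩

theorem homogeneousInMasses_normNum {f : AlgField N ν}
    (hf : f ∈ algebraicMassScaleInvariants N ν) : HomogeneousInMasses (normNum f) := by
  obtain ⟨t, ht⟩ := exists_not_isOfFinOrder
  obtain ⟨k, hk, h⟩ := exists_massScale_pow_eq (isAlgebraic_conjProd hf) t
  refine exists_isWeightedHomogeneous_of_associated (t := t ^ k) ?_ ?_
  · simpa [isOfFinOrder_pow, hk.ne'] using ht
  · have hnum := associated_num_massScale (t ^ k) (conjProd f)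
    rw [h] at hnum
    exact hnum.symm

theorem HomogeneousInMasses.of_dvd {P Q : Poly N ν} (hP : HomogeneousInMasses P) (hP₀ : P ≠ 0)
    (hQ : Q ∣ P) : HomogeneousInMasses Q :=
  have ⟨_, ht⟩ := exists_not_isOfFinOrder
  hP.elim fun _ h => exists_isWeightedHomogeneous_of_dvd ht hP₀ h hQ

end MassScaling

end HardBall

end

theorem proposition3p2_general {N ν n : ℕ} {r : ℝ} (hr : r ≠ 0)
    (S : HardBall.OrbitStructure N ν n r) {f : HardBall.AlgField N ν}
    (hf : f ∈ Submodule.span ℂ S.minors) :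
    HardBall.HomogeneousInMasses (HardBall.normNum f) ∧
      (HardBall.normNum f ≠ 0 → ∀ Q : HardBall.Poly N ν, Q ∣ HardBall.normNum f →
        HardBall.HomogeneousInMasses Q) := by
  have hspan : Submodule.span ℂ S.minors ≤
      (HardBall.algebraicMassScaleInvariants N ν).toSubalgebra.toSubmodule :=
    Submodule.span_le.2 (S.minors_subset_algebraicMassScaleInvariants hr)
  have hP := HardBall.homogeneousInMasses_normNum (hspan hf)
  exact ⟨hP, fun hP₀ _ hQ => hP.of_dvd hP₀ hQ⟩

theorem proposition3p2 (N ν n : ℕ) (hN : 2 ≤ N) (hν : 2 ≤ ν) (r : ℝ) (hr : 0 < r)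
    (S : HardBall.OrbitStructure N ν n r)
    (s : ℕ) (f : Fin s → HardBall.AlgField N ν) (hf : S.IsNonSufficiencySystem f) :
    (∀ k, HardBall.HomogeneousInMasses (HardBall.normNum (f k))) ∧
      ((∃ k, HardBall.normNum (f k) ≠ 0) →
        ∀ Q : HardBall.Poly N ν, (∀ k, Q ∣ HardBall.normNum (f k)) →
          HardBall.HomogeneousInMasses Q) := by
  have h k := proposition3p2_general hr.ne' S
    (hf ▸ Submodule.subset_span ⟨k, rfl⟩ : f k ∈ Submodule.span ℂ S.minors)
  exact ⟨fun k => (h k).1, fun ⟨k, hk⟩ Q hQ => (h k).2 hk Q (hQ k)⟩
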